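/- Let $\mathbb K$ be a field, let $a\ge 2$ be an integer, and let $G=C_{2a}$ be the cycle with $2a$ vertices. **Graphical dimension.** Let $H$ be a connected bipartite graph with parts $A$, $B$, $|A|\le |B|$. A standard drawing $\Gamma$ of $H$ is a labelling of $A$ by $1,\dots,|A|$ and of $B$ by $1',\dots,|B|'$, with the parts named so that $|A|\le|B|$. Let $r(\Gamma)$ be the largest integer $0\le r\le |A|$ such that $\{1,1'\},\dots,\{r,r'\}$ are edges of $H$ and, for all $i\le r$ and $j<i$, $\{i,j'\}$ is not an edge of $H$. Put $\operatorname{gdim}(H)=1+\max_\Gamma r(\Gamma)$. **The algebra.** Let $V$ be the vertex set of $G$, $S=\mathbb K[x_v : v\in V]$, $\mathfrak m=(x_v : v\in V)$. For $k\ge 0$, a $k$-cover of $G$ is a vector $c\in\mathbb N^{V}$ with $c_i+c_j\ge k$ for every edge $\{i,j\}$ of $G$. Let $A(G)_k\subseteq S[t]$ be the $\mathbb K$-span of the monomials $x^{c}t^k$ with $c$ a $k$-cover, let $A(G)=\bigoplus_{k\ge0}A(G)_k$ (an $S$-subalgebra of $S[t]$), and let $\bar A(G)=A(G)/\mathfrak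 m A(G)$, graded by the images $\bar A(G)_k$ of the $A(G)_k$. Then $$\operatorname{gdim}(G)=\dim \bar A(G)=a,$$ where $\dim$ is the Krull dimension. Moreover, the Hilbert function $k\mapsto\dim_{\mathbb K}\bar A(G)_k$ agrees for all large $k$ with a polynomial of degree $d=\dim\bar A(G)-1$, with leading coefficient $e(\bar A(G))/d!$, and the multiplicity $e(\bar A(G))$ is a (positive) integer satisfying $$e(\bar A(G))\le\binom a2\,(a-2)!.$$ -/

import Mathlib

/-! ### Covers, the vertex cover algebra and its fiber cone -/

/-- `c` is a `k`-cover of `G`: `c i + c j ≥ k` for every edge `{i, j}`. If `G` has an edge and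
`k ≥ 1` then such a `c` is automatically nonzero; for `k = 0` the zero vector is admitted, so that
the degree-zero part of the vertex cover algebra is the whole polynomial ring (it contains `1`). -/
def IsCover {V : Type*} (G : SimpleGraph V) (k : ℕ) (c : V →₀ ℕ) : Prop :=
  ∀ i j, G.Adj i j → k ≤ c i + c j

/-- The `K`-span, in `S = K[x_v : v ∈ V]`, of the monomials `x ^ c` with `c` a `k`-cover of `G`. -/
noncomputable def coverSpan (K : Type*) [Field K] {V : Type*} (G : SimpleGraph V) (k : ℕ) :
    Submodule K (MvPolynomial V K) :=
  MvPolynomial.restrictSupport K {c | IsCover G k c}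

theorem mem_coverSpan {K : Type*} [Field K] {V : Type*} {G : SimpleGraph V} {k : ℕ}
    {p : MvPolynomial V K} : p ∈ coverSpan K G k ↔ ∀ c ∈ p.support, IsCover G k c :=
  Iff.rfl

/-- The homogeneous component `A(G)_k ⊆ S[t]`: the `K`-span of the monomials `x ^ c * t ^ k` with
`c` a `k`-cover of `G`. -/
noncomputable def coverPiece (K : Type*) [Field K] {V : Type*} (G : SimpleGraph V) (k : ℕ) :
    Submodule K (Polynomial (MvPolynomial V K)) :=
  (coverSpan K G k).map ((Polynomial.monomial k).restrictScalars K)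

theorem coverSpan_mul {K : Type*} [Field K] {V : Type*} {G : SimpleGraph V} {k l : ℕ}
    {p q : MvPolynomial V K} (hp : p ∈ coverSpan K G k) (hq : q ∈ coverSpan K G l) :
    p * q ∈ coverSpan K G (k + l) := by
  classical
  rw [mem_coverSpan] at *
  intro c hc i j hij
  obtain ⟨u, hu, v, hv, rfl⟩ := Finset.mem_add.mp (MvPolynomial.support_mul p q hc)
  have h1 := hp u hu i j hij
  have h2 := hq v hv i j hij
  simp only [Finsupp.add_apply]
  omega

theorem mem_coverSpan_zero {K : Type*} [Field K] {V : Type*} {G : SimpleGraph V}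
    (p : MvPolynomial V K) : p ∈ coverSpan K G 0 :=
  fun _ _ _ _ _ => Nat.zero_le _

/-- The vertex cover algebra `A(G) = ⨁ₖ A(G)_k ⊆ S[t]`, an `S`-subalgebra of `S[t]`: a polynomial
in `t` belongs to it iff, for every `k`, its component of degree `k` in `t` lies in `A(G)_k`. -/
noncomputable def vertexCoverAlgebra (K : Type*) [Field K] {V : Type*} (G : SimpleGraph V) :
    Subalgebra (MvPolynomial V K) (Polynomial (MvPolynomial V K)) where
  carrier := {f | ∀ k, f.coeff k ∈ coverSpan K G k}
  mul_mem' := by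
    intro f g hf hg k
    rw [Polynomial.coeff_mul]
    refine Submodule.sum_mem _ fun x hx => ?_
    rw [← Finset.HasAntidiagonal.mem_antidiagonal.mp hx]
    exact coverSpan_mul (hf _) (hg _)
  add_mem' := by
    intro f g hf hg k
    rw [Polynomial.coeff_add]
    exact Submodule.add_mem _ (hf k) (hg k)
  algebraMap_mem' := by
    intro p k
    rw [Polynomial.algebraMap_apply, Polynomial.coeff_C]
    split_ifs with h
    · subst h; exact mem_coverSpan_zero _
    · exact Submodule.zero_mem _

/-- The vertex cover algebra `A(G)` as a ring. -/
def VertexCoverRing (K : Type*) [Field K] {V : Type*} (G : SimpleGraph V) : Type _ :=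
  vertexCoverAlgebra K G

noncomputable instance (K : Type*) [Field K] {V : Type*} (G : SimpleGraph V) :
    CommRing (VertexCoverRing K G) :=
  (vertexCoverAlgebra K G).toCommRing

noncomputable instance (K : Type*) [Field K] {V : Type*} (G : SimpleGraph V) :
    Algebra (MvPolynomial V K) (VertexCoverRing K G) :=
  (vertexCoverAlgebra K G).algebra

noncomputable instance (K : Type*) [Field K] {V : Type*} (G : SimpleGraph V) :
    Algebra K (VertexCoverRing K G) :=
  ((algebraMap (MvPolynomial V K) (VertexCoverRing K G)).comp
    (algebraMap K (MvPolynomial V K))).toAlgebra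

/-- The inclusion `A(G) ⊆ S[t]`. -/
noncomputable def VertexCoverRing.incl (K : Type*) [Field K] {V : Type*} (G : SimpleGraph V) :
    VertexCoverRing K G →ₐ[K] Polynomial (MvPolynomial V K) where
  toFun f := f.1
  map_one' := rfl
  map_mul' _ _ := rfl
  map_zero' := rfl
  map_add' _ _ := rfl
  commutes' _ := rfl

/-- The extension `𝔪 A(G)` of the irrelevant maximal ideal `𝔪 = (x_v : v ∈ V)` of `S`. -/
noncomputable def irrelevantExtension (K : Type*) [Field K] {V : Type*} (G : SimpleGraph V) :
    Ideal (VertexCoverRing K G) :=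
  (Ideal.span (Set.range (MvPolynomial.X : V → MvPolynomial V K))).map
    (algebraMap (MvPolynomial V K) (VertexCoverRing K G))

/-- The fiber cone `Ā(G) = A(G) / 𝔪 A(G)`. -/
abbrev FiberCone (K : Type*) [Field K] {V : Type*} (G : SimpleGraph V) : Type _ :=
  VertexCoverRing K G ⧸ irrelevantExtension K G

/-- The homogeneous component `Ā(G)_k`: the image of `A(G)_k` in `Ā(G)`. -/
noncomputable def fiberConeGrading (K : Type*) [Field K] {V : Type*} (G : SimpleGraph V) (k : ℕ) :
    Submodule K (FiberCone K G) :=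
  ((coverPiece K G k).comap (VertexCoverRing.incl K G).toLinearMap).map
    (Ideal.Quotient.mkₐ K (irrelevantExtension K G)).toLinearMap

/-! ### Hilbert function and multiplicity of a graded algebra -/

/-- The Hilbert function `k ↦ dim_K R_k` of a graded algebra `R = ⨁ₖ R_k`. -/
noncomputable def hilbertFunction {K R : Type*} [Field K] [CommRing R] [Algebra K R]
    (𝒜 : ℕ → Submodule K R) (k : ℕ) : ℕ :=
  Module.finrank K (𝒜 k)

/-- `e` is the multiplicity of the standard graded algebra `R = ⨁ₖ R_k`, of Krull dimension
`d + 1 ≥ 1`: the Hilbert function agrees for large `k` with a polynomial of degree `d`, whose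
leading coefficient is `e / d!`. (There is at most one such `e`.) -/
def HasMultiplicity {K R : Type*} [Field K] [CommRing R] [Algebra K R]
    (𝒜 : ℕ → Submodule K R) (e : ℚ) : Prop :=
  ∃ (d : ℕ) (P : Polynomial ℚ),
    ringKrullDim R = ((d + 1 : ℕ) : WithBot ℕ∞) ∧
    (∀ᶠ k : ℕ in Filter.atTop, (hilbertFunction 𝒜 k : ℚ) = P.eval (k : ℚ)) ∧
    P.degree = (d : WithBot ℕ) ∧ e = (d.factorial : ℚ) * P.leadingCoeff

/-! ### Graphical dimension -/

/-- A standard drawing of a connected bipartite graph: the two sides `A`, `B` of the bipartition,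
of sizes `a ≤ b`, are listed from left to right on an upper and on a lower horizontal line.
Positions are counted from `0`. -/
structure StandardDrawing {V : Type*} (G : SimpleGraph V) where
  /-- number of vertices on the upper line -/
  a : ℕ
  /-- number of vertices on the lower line -/
  b : ℕ
  a_le_b : a ≤ b
  /-- the vertex in each position of the upper line (`Sum.inl`) and the lower line (`Sum.inr`) -/
  vertex : Fin a ⊕ Fin b ≃ V
  upper_not_adj : ∀ i j : Fin a, ¬ G.Adj (vertex (Sum.inl i)) (vertex (Sum.inl j))
  lower_not_adj : ∀ i j : Fin b, ¬ G.Adj (vertex (Sum.inr i)) (vertex (Sum.inr j))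

/-- The upper vertex in position `i` and the lower vertex in position `j` are joined. -/
def StandardDrawing.Joined {V : Type*} {G : SimpleGraph V} (Γ : StandardDrawing G)
    (i : Fin Γ.a) (j : Fin Γ.b) : Prop :=
  G.Adj (Γ.vertex (Sum.inl i)) (Γ.vertex (Sum.inr j))

/-- The first `r` positions carry vertical edges, and no slash edge (an edge whose upper end
is strictly to the right of its lower end) starts from the first `r` upper vertices. -/
def StandardDrawing.Admissible {V : Type*} {G : SimpleGraph V} (Γ : StandardDrawing G)
    (r : ℕ) : Prop :=
  r ≤ Γ.a ∧
  (∀ (i : Fin Γ.a) (j : Fin Γ.b), (i : ℕ) < r → (j : ℕ) = i → Γ.Joined i j) ∧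
  (∀ (i : Fin Γ.a) (j : Fin Γ.b), (i : ℕ) < r → (j : ℕ) < i → ¬ Γ.Joined i j)

/-- `r(Γ)`: the largest `r` (in `{0, …, a}`) that is admissible for the drawing. -/
noncomputable def StandardDrawing.r {V : Type*} {G : SimpleGraph V} (Γ : StandardDrawing G) : ℕ :=
  sSup {r | Γ.Admissible r}

/-- The graphical dimension of a (finite) connected bipartite graph: one plus the maximum of
`r(Γ)` over all standard drawings `Γ`. -/
noncomputable def graphicalDimension {V : Type*} (G : SimpleGraph V) : ℕ :=
  1 + sSup {r | ∃ Γ : StandardDrawing G, Γ.r = r}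

/-! The whole computation runs on monomials. Multiplying `x ^ c * t ^ k` by a variable raises one
entry of `c`, so modulo `𝔪 A(G)` exactly the monomials of basic covers survive, and they form a
basis of the fiber cone; the Hilbert function counts basic `k`-covers
(`hilbertFunction_fiberConeGrading`).

On the cycle with `2a` vertices a basic `k`-cover is determined by its odd entries `q : Fin a → {0,
…, k}`: each even entry must be `k` minus the smaller of its two odd neighbours, and what remains of
basicness is that `q` has no strict cyclic peak (`isBasicCover_cycleGraph`). Sorting such `q` by
image gives the count `∑ m < a, binom(k + 1, m) * N m`, where `N m` is `noPeakSurjections a m`. The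
terms with `m ≥ a` vanish because a maximal value is attained at least twice. The count is therefore
a polynomial in `k` of degree `a - 1`, and the multiplicity is `N (a - 1)`. In a sequence counted
there, the top value occurs exactly twice and the other `a - 2` values once each, whence the bound
`binom(a, 2) * (a - 2)!`.

For the Krull dimension, a chain of primes yields algebraically independent elements, so the growth
of the Hilbert function bounds the dimension above by `a` (`ringKrullDim_le_of_filtration`). Below,
the covers tight on a fixed edge cover form a free monoid of rank `a`; killing all other monomials
maps the fiber cone onto a polynomial ring in `a` variables (`exists_surjective_algHom_fiberCone`).

The graphical dimension is elementary: `r = a` would leave the last upper vertex with one neighbour,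
and the drawing placing odd vertices above even ones reaches `a - 1`. -/

/-! ### Krull dimension and growth -/

/-- Elements chosen along a chain of primes satisfy no polynomial relation modulo the smallest
prime of the chain. -/
theorem eq_zero_of_aeval_mem_of_primeChain {K R : Type*} [Field K] [CommRing R] [Algebra K R] :
    ∀ (s : ℕ) (P : Fin (s + 1) → Ideal R) (_ : ∀ i, (P i).IsPrime)
      (_ : ∀ i : Fin s, P i.castSucc ≤ P i.succ) (x : Fin s → R)
      (_ : ∀ i : Fin s, x i ∈ P i.succ) (_ : ∀ i : Fin s, x i ∉ P i.castSucc)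
      (f : MvPolynomial (Fin s) K), MvPolynomial.aeval x f ∈ P 0 → f = 0
  | 0, P, hP, _, x, _, _, f, hf => by
    rw [MvPolynomial.eq_C_of_isEmpty f] at hf ⊢
    by_contra h
    have hc : MvPolynomial.coeff 0 f ≠ 0 := fun h0 => h (by rw [h0, map_zero])
    rw [MvPolynomial.aeval_C] at hf
    exact (hP 0).ne_top (Ideal.eq_top_of_isUnit_mem _ hf
      ((IsUnit.mk0 _ hc).map (algebraMap K R)))
  | s + 1, P, hP, hle, x, hx, hx', f, hf => by
    have IH := eq_zero_of_aeval_mem_of_primeChain (K := K) s (fun i => P i.succ)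
      (fun i => hP _) (fun i => hle i.succ) (fun i => x i.succ) (fun i => hx i.succ)
      (fun i => hx' i.succ)
    -- View the relation as a polynomial in `x 0`. Since `x 0 ∈ P 1` and `P 0 ≤ P 1`, its constant
    -- term is a relation modulo `P 1`, zero by the shorter chain. As `x 0 ∉ P 0` and `P 0` is
    -- prime, `x 0` can be cancelled, which lowers the degree.
    have key : ∀ (n : ℕ) (g : Polynomial (MvPolynomial (Fin s) K)), g.natDegree < n →
        Polynomial.eval₂ (MvPolynomial.aeval (R := K) fun i : Fin s => x i.succ).toRingHom
          (x 0) g ∈ P 0 → g = 0 := by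
      intro n
      induction n with
      | zero => intro g hg; omega
      | succ n ih =>
        intro g hg h
        have hsplit := Polynomial.divX_mul_X_add g
        rw [← hsplit, Polynomial.eval₂_add, Polynomial.eval₂_mul, Polynomial.eval₂_X,
          Polynomial.eval₂_C] at h
        have hc : g.coeff 0 = 0 := by
          refine IH _ ?_
          have h1 := hle 0 h
          exact (Ideal.add_mem_iff_right _ (Ideal.mul_mem_left _ _ (hx 0))).mp h1
        rw [hc, map_zero, add_zero] at h
        have h2 := ((hP 0).mem_or_mem h).resolve_right (hx' 0)
        have h3 : g.divX = 0 := by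
          by_cases hd : g.natDegree = 0
          · rw [Polynomial.eq_C_of_natDegree_eq_zero hd, Polynomial.divX_C]
          · refine ih _ ?_ h2
            rw [Polynomial.natDegree_divX_eq_natDegree_tsub_one]
            omega
        rw [← hsplit, h3, hc, map_zero, zero_mul, add_zero]
    have hev : MvPolynomial.aeval x f = Polynomial.eval₂
        (MvPolynomial.aeval (R := K) fun i : Fin s => x i.succ).toRingHom (x 0)
        (MvPolynomial.finSuccEquiv K s f) := by
      have : (MvPolynomial.aeval x : MvPolynomial (Fin (s + 1)) K →ₐ[K] R).toRingHom =
          (Polynomial.eval₂RingHom (MvPolynomial.aeval (R := K)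
            fun i : Fin s => x i.succ).toRingHom (x 0)).comp
            (MvPolynomial.finSuccEquiv K s).toRingEquiv.toRingHom := by
        refine MvPolynomial.ringHom_ext (fun r => ?_) (fun i => ?_)
        · simp [MvPolynomial.finSuccEquiv_apply]
        · refine Fin.cases ?_ (fun j => ?_) i <;> simp [MvPolynomial.finSuccEquiv_apply]
      exact DFunLike.congr_fun this f
    rw [hev] at hf
    exact (MvPolynomial.finSuccEquiv K s).injective
      ((key _ _ (Nat.lt_succ_self _) hf).trans (map_zero _).symm)

/-- An exponent comparison: `n ^ s ≤ C * (D * n + 1) ^ d` for all `n` forces `s ≤ d`. -/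
theorem le_of_forall_pow_le {s d C D : ℕ} (h : ∀ n : ℕ, n ^ s ≤ C * (D * n + 1) ^ d) : s ≤ d := by
  by_contra! hlt
  -- For `n > 0` one has `D * n + 1 ≤ (D + 1) * n`, so `s > d` would force `n ≤ C * (D + 1) ^ d`.
  set n := C * (D + 1) ^ d + 1 with hn
  have hpos : 0 < n := by omega
  have h1 : n ^ (d + 1) ≤ n ^ s := Nat.pow_le_pow_right hpos hlt
  have h2 : (D * n + 1) ^ d ≤ ((D + 1) * n) ^ d := Nat.pow_le_pow_left (by nlinarith) d
  have h3 : n ^ d * n ≤ n ^ d * (C * (D + 1) ^ d) := by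
    calc n ^ d * n = n ^ (d + 1) := (pow_succ _ _).symm
      _ ≤ C * (D * n + 1) ^ d := h1.trans (h n)
      _ ≤ C * ((D + 1) * n) ^ d := Nat.mul_le_mul_left _ h2
      _ = n ^ d * (C * (D + 1) ^ d) := by rw [mul_pow]; ring
  have := Nat.le_of_mul_le_mul_left h3 (pow_pos hpos d)
  omega

/-- The Krull dimension of an algebra is bounded by the growth of any exhaustive multiplicative
filtration by finite-dimensional subspaces. -/
theorem ringKrullDim_le_of_filtration {K R : Type*} [Field K] [CommRing R] [Algebra K R]
    (F : ℕ → Submodule K R) (hmono : Monotone F) (hone : 1 ∈ F 0)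
    (hmul : ∀ m n x y, x ∈ F m → y ∈ F n → x * y ∈ F (m + n)) (hex : ∀ x, ∃ n, x ∈ F n)
    [∀ n, FiniteDimensional K (F n)] (C d : ℕ)
    (hF : ∀ n, Module.finrank K (F n) ≤ C * (n + 1) ^ d) : ringKrullDim R ≤ d := by
  refine iSup_le fun p => ?_
  have hlt : ∀ i : Fin p.length, ∃ x, x ∈ (p i.succ).asIdeal ∧ x ∉ (p i.castSucc).asIdeal :=
    fun i => SetLike.exists_of_lt (p.step i)
  choose x hx hx' using hlt
  have hinj : Function.Injective (MvPolynomial.aeval x : MvPolynomial (Fin p.length) K →ₐ[K] R) := by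
    rw [injective_iff_map_eq_zero]
    intro f hf
    refine eq_zero_of_aeval_mem_of_primeChain p.length (fun i => (p i).asIdeal)
      (fun i => (p i).isPrime) (fun i => (p.step i).le) x hx hx' f ?_
    rw [hf]; exact Ideal.zero_mem _
  choose N hN using hex
  set m := Finset.univ.sup (fun i => N (x i))
  have hxm : ∀ i, x i ∈ F m := fun i =>
    hmono (Finset.le_sup (f := fun i => N (x i)) (Finset.mem_univ i)) (hN _)
  have hpow : ∀ i e, x i ^ e ∈ F (e * m) := by
    intro i e
    induction e with
    | zero => simpa using hone
    | succ e ih => rw [pow_succ, Nat.succ_mul]; exact hmul _ _ _ _ ih (hxm i)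
  have hprod : ∀ (t : Finset (Fin p.length)) (e : Fin p.length → ℕ),
      ∏ i ∈ t, x i ^ e i ∈ F (∑ i ∈ t, e i * m) := by
    intro t e
    induction t using Finset.induction_on with
    | empty => simpa using hone
    | insert i t hi ih =>
      rw [Finset.prod_insert hi, Finset.sum_insert hi]
      exact hmul _ _ _ _ (hpow _ _) ih
  have hle : p.length ≤ d := by
    -- With `s = p.length`, the `n ^ s` monomials in the `x i` with all exponents below `n` are
    -- independent and lie in `F (s * m * n)`.
    refine le_of_forall_pow_le (C := C) (D := p.length * m) fun n => ?_
    let v : (Fin p.length → Fin n) → F (p.length * m * n) := fun e =>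
      ⟨∏ i, x i ^ (e i : ℕ), hmono (by
        calc ∑ i, (e i : ℕ) * m ≤ ∑ _i : Fin p.length, n * m :=
              Finset.sum_le_sum fun i _ => Nat.mul_le_mul_right _ (e i).2.le
          _ = p.length * m * n := by simp; ring) (hprod _ _)⟩
    have hv : LinearIndependent K v := by
      refine LinearIndependent.of_comp (F (p.length * m * n)).subtype ?_
      have h1 := ((MvPolynomial.basisMonomials (Fin p.length) K).linearIndependent.map'
        (MvPolynomial.aeval x : MvPolynomial (Fin p.length) K →ₐ[K] R).toLinearMap
        (LinearMap.ker_eq_bot.mpr hinj)).comp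
        (fun e : Fin p.length → Fin n => Finsupp.equivFunOnFinite.symm fun i => (e i : ℕ)) (by
          intro e e' h
          funext i
          exact Fin.ext (DFunLike.congr_fun h i))
      have h2 : (fun e : Fin p.length → Fin n => ∏ i, x i ^ (e i : ℕ)) =
          ((MvPolynomial.aeval x : MvPolynomial (Fin p.length) K →ₐ[K] R).toLinearMap ∘
            MvPolynomial.basisMonomials (Fin p.length) K) ∘
            fun e : Fin p.length → Fin n => Finsupp.equivFunOnFinite.symm fun i => (e i : ℕ) := by
        funext e
        simp [MvPolynomial.aeval_monomial, Finsupp.prod_fintype]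
      rw [← h2] at h1
      exact h1
    have := hv.fintype_card_le_finrank
    simpa using this.trans (hF _)
  exact_mod_cast hle

/-! ### The monomial basis of the fiber cone -/

section FiberCone

variable {V : Type*} {G : SimpleGraph V}

/-- A `k`-cover is basic if it cannot be lowered at any vertex. -/
def IsBasicCover (G : SimpleGraph V) (k : ℕ) (c : V →₀ ℕ) : Prop :=
  IsCover G k c ∧ ∀ v, c v ≠ 0 → ∃ w, G.Adj v w ∧ c v + c w = k

theorem IsCover.add {k l : ℕ} {c d : V →₀ ℕ} (hc : IsCover G k c) (hd : IsCover G l d) :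
    IsCover G (k + l) (c + d) := by
  intro i j hij
  have h1 := hc i j hij
  have h2 := hd i j hij
  simp only [Finsupp.add_apply]
  omega

theorem isCover_zero (c : V →₀ ℕ) : IsCover G 0 c := fun _ _ _ => Nat.zero_le _

/-- Edges at `v` already have weight at least `k` in `c`, so none is tight once `v` is raised. -/
theorem IsCover.not_isBasicCover_add_single {k : ℕ} {c : V →₀ ℕ} (hc : IsCover G k c) (v : V) :
    ¬ IsBasicCover G k (c + Finsupp.single v 1) := by
  rintro ⟨-, h⟩
  obtain ⟨w, hw, hk⟩ := h v (by simp)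
  have := hc v w hw
  have hne : w ≠ v := hw.ne'
  simp [hne.symm] at hk
  omega

theorem IsCover.exists_eq_add_single {k : ℕ} {c : V →₀ ℕ} (hc : IsCover G k c)
    (hb : ¬ IsBasicCover G k c) :
    ∃ d v, IsCover G k d ∧ c = d + Finsupp.single v 1 := by
  classical
  simp only [IsBasicCover, hc, true_and, not_forall, not_exists, not_and] at hb
  obtain ⟨v, hv, hw⟩ := hb
  have hle : Finsupp.single v 1 ≤ c := by
    rw [Finsupp.single_le_iff]; omega
  refine ⟨c - Finsupp.single v 1, v, ?_, (tsub_add_cancel_of_le hle).symm⟩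
  intro i j hij
  have h0 := hc i j hij
  have hne := hij.ne
  simp only [Finsupp.tsub_apply, Finsupp.single_apply]
  split_ifs with h1 h2 h2
  · exact absurd (h1.symm.trans h2) hne
  · subst h1
    have := hw j hij
    omega
  · subst h2
    have := hw i hij.symm
    omega
  · omega

variable (K : Type*) [Field K]

theorem VertexCoverRing.incl_injective (G : SimpleGraph V) :
    Function.Injective (VertexCoverRing.incl K G) := fun _ _ h => Subtype.ext h

/-- The element `x ^ c * t ^ k` of the vertex cover algebra. -/
noncomputable def coverMonomial (k : ℕ) (c : V →₀ ℕ) (hc : IsCover G k c) :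
    VertexCoverRing K G :=
  ⟨Polynomial.monomial k (MvPolynomial.monomial c 1), by
    intro l
    rw [Polynomial.coeff_monomial]
    split_ifs with h
    · subst h
      exact (MvPolynomial.monomial_mem_restrictSupport K).mpr (Or.inl hc)
    · exact Submodule.zero_mem _⟩

theorem incl_coverMonomial (k : ℕ) (c : V →₀ ℕ) (hc : IsCover G k c) :
    VertexCoverRing.incl K G (coverMonomial K k c hc) =
      Polynomial.monomial k (MvPolynomial.monomial c 1) := rfl

theorem coverMonomial_mul {k l : ℕ} {c d : V →₀ ℕ} (hc : IsCover G k c) (hd : IsCover G l d) :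
    coverMonomial K k c hc * coverMonomial K l d hd = coverMonomial K (k + l) (c + d) (hc.add hd) := by
  apply VertexCoverRing.incl_injective
  rw [map_mul]
  simp only [incl_coverMonomial, Polynomial.monomial_mul_monomial, MvPolynomial.monomial_mul,
    one_mul]

theorem coverMonomial_zero : coverMonomial K 0 0 (isCover_zero (G := G) 0) = 1 := by
  apply VertexCoverRing.incl_injective
  rw [incl_coverMonomial, map_one (VertexCoverRing.incl K G)]
  rfl

theorem algebraMap_X_eq_coverMonomial (v : V) :
    algebraMap (MvPolynomial V K) (VertexCoverRing K G) (MvPolynomial.X v) =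
      coverMonomial K 0 (Finsupp.single v 1) (isCover_zero _) := rfl

theorem comap_coverPiece (G : SimpleGraph V) (k : ℕ) :
    (coverPiece K G k).comap (VertexCoverRing.incl K G).toLinearMap =
      Submodule.span K (Set.range fun c : {c // IsCover G k c} => coverMonomial K k c.1 c.2) := by
  have h : coverPiece K G k = (Submodule.span K (Set.range fun c : {c // IsCover G k c} =>
      coverMonomial K k c.1 c.2)).map (VertexCoverRing.incl K G).toLinearMap := by
    rw [coverPiece, coverSpan, MvPolynomial.restrictSupport_eq_span, LinearMap.map_span,
      LinearMap.map_span, ← Set.range_comp]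
    congr 1
    ext f
    constructor
    · rintro ⟨_, ⟨c, hc, rfl⟩, rfl⟩
      exact ⟨⟨c, hc⟩, rfl⟩
    · rintro ⟨⟨c, hc⟩, rfl⟩
      exact ⟨_, ⟨c, hc, rfl⟩, rfl⟩
  rw [h, Submodule.comap_map_eq_of_injective]
  exact VertexCoverRing.incl_injective K G

/-- The component of degree `k` in `t` of an element of the vertex cover algebra. -/
noncomputable def VertexCoverRing.component (f : VertexCoverRing K G) (k : ℕ) :
    VertexCoverRing K G :=
  ⟨Polynomial.monomial k ((VertexCoverRing.incl K G f).coeff k), by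
    intro l
    rw [Polynomial.coeff_monomial]
    split_ifs with h
    · subst h; exact f.2 _
    · exact Submodule.zero_mem _⟩

theorem VertexCoverRing.component_mem (f : VertexCoverRing K G) (k : ℕ) :
    f.component K k ∈ (coverPiece K G k).comap (VertexCoverRing.incl K G).toLinearMap :=
  ⟨(VertexCoverRing.incl K G f).coeff k, f.2 k, rfl⟩

theorem span_coverMonomial (G : SimpleGraph V) :
    Submodule.span K (Set.range fun c : {c : ℕ × (V →₀ ℕ) // IsCover G c.1 c.2} =>
      coverMonomial K c.1.1 c.1.2 c.2) = ⊤ := by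
  rw [eq_top_iff]
  rintro f -
  have hf : f = ∑ k ∈ (VertexCoverRing.incl K G f).support, f.component K k := by
    apply VertexCoverRing.incl_injective
    rw [map_sum]
    exact (VertexCoverRing.incl K G f).as_sum_support
  rw [hf]
  refine Submodule.sum_mem _ fun k _ => ?_
  have h := f.component_mem K k
  rw [comap_coverPiece] at h
  refine Submodule.span_mono ?_ h
  rintro _ ⟨c, rfl⟩
  exact ⟨⟨(k, c.1), c.2⟩, rfl⟩

/-- The image of `x ^ c * t ^ k` in the fiber cone. -/
noncomputable def fiberMonomial (k : ℕ) (c : V →₀ ℕ) (hc : IsCover G k c) : FiberCone K G :=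
  Ideal.Quotient.mkₐ K (irrelevantExtension K G) (coverMonomial K k c hc)

theorem fiberMonomial_mul {k l : ℕ} {c d : V →₀ ℕ} (hc : IsCover G k c) (hd : IsCover G l d) :
    fiberMonomial K k c hc * fiberMonomial K l d hd =
      fiberMonomial K (k + l) (c + d) (hc.add hd) := by
  rw [fiberMonomial, fiberMonomial, ← map_mul, coverMonomial_mul, fiberMonomial]

theorem fiberMonomial_eq_zero {k : ℕ} {c : V →₀ ℕ} (hc : IsCover G k c)
    (hb : ¬ IsBasicCover G k c) : fiberMonomial K k c hc = 0 := by
  obtain ⟨d, v, hd, rfl⟩ := hc.exists_eq_add_single hb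
  have h : coverMonomial K k (d + Finsupp.single v 1) hc =
      coverMonomial K k d hd * coverMonomial K 0 (Finsupp.single v 1) (isCover_zero _) := by
    rw [coverMonomial_mul]
    rfl
  rw [fiberMonomial, h]
  refine Ideal.Quotient.eq_zero_iff_mem.mpr (Ideal.mul_mem_left _ _ ?_)
  rw [← algebraMap_X_eq_coverMonomial]
  exact Ideal.mem_map_of_mem _ (Ideal.subset_span ⟨v, rfl⟩)

/-- Elements of `𝔪 A(G)` are combinations of monomials with exponent a cover plus a unit vector, and
such exponents are never basic. This gives independence of the basic monomials in the quotient. -/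
theorem coeff_eq_zero_of_mem_irrelevantExtension {f : VertexCoverRing K G}
    (hf : f ∈ irrelevantExtension K G) {k : ℕ} {c : V →₀ ℕ} (hb : IsBasicCover G k c) :
    MvPolynomial.coeff c ((VertexCoverRing.incl K G f).coeff k) = 0 := by
  classical
  rw [irrelevantExtension, Ideal.map_span] at hf
  -- The extra factor `g` makes the claim stable under multiplication by ring elements, as the span
  -- induction requires.
  suffices h : ∀ k c, IsBasicCover G k c → ∀ g : VertexCoverRing K G,
      MvPolynomial.coeff c ((VertexCoverRing.incl K G (g * f)).coeff k) = 0 by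
    simpa using h k c hb 1
  refine Submodule.span_induction (p := fun f _ => ∀ k c, IsBasicCover G k c →
    ∀ g : VertexCoverRing K G,
      MvPolynomial.coeff c ((VertexCoverRing.incl K G (g * f)).coeff k) = 0) ?_ ?_ ?_ ?_ hf
  · rintro _ ⟨_, ⟨v, rfl⟩, rfl⟩ k c hb g
    have h1 : VertexCoverRing.incl K G (algebraMap (MvPolynomial V K) _ (MvPolynomial.X v)) =
        Polynomial.C (MvPolynomial.X v) := rfl
    rw [map_mul, h1, Polynomial.coeff_mul_C, MvPolynomial.coeff_mul_X']
    split_ifs with hv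
    · by_contra hne
      have hcov := g.2 k (MvPolynomial.mem_support_iff.mpr hne)
      have hle : Finsupp.single v 1 ≤ c := by
        rw [Finsupp.single_le_iff]
        exact Nat.one_le_iff_ne_zero.mpr (Finsupp.mem_support_iff.mp hv)
      refine IsCover.not_isBasicCover_add_single hcov v ?_
      rwa [tsub_add_cancel_of_le hle]
    · rfl
  · intro k c _ g
    rw [mul_zero, map_zero, Polynomial.coeff_zero, MvPolynomial.coeff_zero]
  · intro x y _ _ hx hy k c hb g
    rw [mul_add, map_add, Polynomial.coeff_add, MvPolynomial.coeff_add, hx k c hb, hy k c hb,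
      add_zero]
  · intro a x _ hx k c hb g
    rw [smul_eq_mul, ← mul_assoc]
    exact hx k c hb _

theorem linearIndependent_fiberMonomial (G : SimpleGraph V) (k : ℕ) :
    LinearIndependent K fun c : {c // IsBasicCover G k c} => fiberMonomial K k c.1 c.2.1 := by
  classical
  rw [linearIndependent_iff']
  intro s g hg i hi
  have h1 : (∑ c ∈ s, g c • coverMonomial K k c.1 c.2.1) ∈ irrelevantExtension K G := by
    rw [← Ideal.Quotient.eq_zero_iff_mem, ← hg]
    change Ideal.Quotient.mkₐ K (irrelevantExtension K G) _ = _
    rw [map_sum]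
    exact Finset.sum_congr rfl fun c _ => map_smul _ _ _
  have h2 := coeff_eq_zero_of_mem_irrelevantExtension K h1 i.2
  rw [map_sum, Polynomial.finsetSum_coeff, MvPolynomial.coeff_sum,
    Finset.sum_eq_single i] at h2
  · rw [map_smul, incl_coverMonomial] at h2
    simpa using h2
  · intro c _ hne
    rw [map_smul, incl_coverMonomial]
    have : c.1 ≠ i.1 := fun h => hne (Subtype.ext h)
    simp [MvPolynomial.coeff_monomial, this]
  · exact fun h => absurd hi h

theorem fiberConeGrading_eq_span (G : SimpleGraph V) (k : ℕ) :
    fiberConeGrading K G k = Submodule.span K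
      (Set.range fun c : {c // IsBasicCover G k c} => fiberMonomial K k c.1 c.2.1) := by
  rw [fiberConeGrading, comap_coverPiece, Submodule.map_span]
  refine le_antisymm (Submodule.span_le.mpr ?_) (Submodule.span_mono ?_)
  · rintro _ ⟨_, ⟨c, rfl⟩, rfl⟩
    by_cases hb : IsBasicCover G k c.1
    · exact Submodule.subset_span ⟨⟨c.1, hb⟩, rfl⟩
    · exact Set.mem_of_eq_of_mem (fiberMonomial_eq_zero K c.2 hb) (Submodule.zero_mem _)
  · rintro _ ⟨c, rfl⟩
    exact ⟨_, ⟨⟨c.1, c.2.1⟩, rfl⟩, rfl⟩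

/-- The Hilbert function of the fiber cone counts basic covers. -/
theorem hilbertFunction_fiberConeGrading (G : SimpleGraph V) (k : ℕ) :
    hilbertFunction (fiberConeGrading K G) k = Nat.card {c // IsBasicCover G k c} := by
  rw [hilbertFunction, fiberConeGrading_eq_span]
  exact Module.finrank_eq_nat_card_basis (Module.Basis.span (linearIndependent_fiberMonomial K G k))

theorem span_fiberMonomial (G : SimpleGraph V) :
    Submodule.span K (Set.range fun c : {c : ℕ × (V →₀ ℕ) // IsBasicCover G c.1 c.2} =>
      fiberMonomial K c.1.1 c.1.2 c.2.1) = ⊤ := by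
  rw [eq_top_iff]
  rintro f -
  obtain ⟨f, rfl⟩ := Ideal.Quotient.mkₐ_surjective K (irrelevantExtension K G) f
  have hf : f ∈ (⊤ : Submodule K (VertexCoverRing K G)) := Submodule.mem_top
  rw [← span_coverMonomial] at hf
  have h := Submodule.mem_map_of_mem
    (f := (Ideal.Quotient.mkₐ K (irrelevantExtension K G)).toLinearMap) hf
  rw [Submodule.map_span] at h
  refine Submodule.span_le.mpr ?_ h
  rintro _ ⟨_, ⟨c, rfl⟩, rfl⟩
  by_cases hb : IsBasicCover G c.1.1 c.1.2
  · exact Submodule.subset_span ⟨⟨c.1, hb⟩, rfl⟩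
  · exact Set.mem_of_eq_of_mem (fiberMonomial_eq_zero K c.2 hb) (Submodule.zero_mem _)

/-- A polynomial bound on the number of basic covers bounds the Krull dimension of the fiber
cone. -/
theorem ringKrullDim_fiberCone_le (G : SimpleGraph V)
    [∀ k, Finite {c // IsBasicCover G k c}] (C d : ℕ)
    (hC : ∀ k, Nat.card {c // IsBasicCover G k c} ≤ C * (k + 1) ^ d) :
    ringKrullDim (FiberCone K G) ≤ (d + 1 : ℕ) := by
  have := fun k => Fintype.ofFinite {c // IsBasicCover G k c}
  let b : (N : ℕ) → (Σ k : Fin (N + 1), {c // IsBasicCover G k c}) → FiberCone K G :=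
    fun N c => fiberMonomial K c.1 c.2.1 c.2.2.1
  have hmem : ∀ N k c (hc : IsCover G k c), k ≤ N →
      fiberMonomial K k c hc ∈ Submodule.span K (Set.range (b N)) := by
    intro N k c hc hk
    by_cases hb : IsBasicCover G k c
    · exact Submodule.subset_span ⟨⟨⟨k, by omega⟩, ⟨c, hb⟩⟩, rfl⟩
    · rw [fiberMonomial_eq_zero K hc hb]; exact Submodule.zero_mem _
  have hmono : Monotone fun N => Submodule.span K (Set.range (b N)) := by
    intro M N hMN
    refine Submodule.span_le.mpr ?_
    rintro _ ⟨c, rfl⟩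
    exact hmem N _ _ _ (by have := c.1.2; omega)
  have hfin : ∀ N, FiniteDimensional K (Submodule.span K (Set.range (b N))) :=
    fun N => FiniteDimensional.span_of_finite K (Set.finite_range _)
  refine ringKrullDim_le_of_filtration (K := K) (fun N => Submodule.span K (Set.range (b N)))
    hmono ?_ ?_ ?_ C (d + 1) ?_
  · have h1 : (1 : FiberCone K G) = fiberMonomial K 0 0 (isCover_zero _) := by
      rw [fiberMonomial, coverMonomial_zero, map_one]
    rw [h1]
    exact hmem 0 0 0 _ le_rfl
  · intro M N x y hx hy
    have h := Submodule.mul_mem_mul hx hy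
    rw [Submodule.span_mul_span] at h
    refine Submodule.span_le.mpr ?_ h
    rintro _ ⟨_, ⟨c, rfl⟩, _, ⟨d, rfl⟩, rfl⟩
    change fiberMonomial K _ _ _ * fiberMonomial K _ _ _ ∈ _
    rw [fiberMonomial_mul]
    exact hmem _ _ _ _ (by have := c.1.2; have := d.1.2; omega)
  · intro x
    have hx : x ∈ (⊤ : Submodule K (FiberCone K G)) := Submodule.mem_top
    rw [← span_fiberMonomial] at hx
    induction hx using Submodule.span_induction with
    | mem x hx =>
      obtain ⟨c, rfl⟩ := hx
      exact ⟨c.1.1, hmem _ _ _ _ le_rfl⟩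
    | zero => exact ⟨0, Submodule.zero_mem _⟩
    | add x y _ _ hx hy =>
      obtain ⟨m, hm⟩ := hx
      obtain ⟨n, hn⟩ := hy
      exact ⟨max m n, Submodule.add_mem _ (hmono (le_max_left m n) hm)
        (hmono (le_max_right m n) hn)⟩
    | smul r x _ hx =>
      obtain ⟨m, hm⟩ := hx
      exact ⟨m, Submodule.smul_mem _ _ hm⟩
  · intro N
    -- Level `N` collects the degrees `0, …, N`, which raises the exponent from `d` to `d + 1`.
    refine (finrank_range_le_card (b N)).trans ?_
    rw [Fintype.card_sigma]
    calc ∑ k : Fin (N + 1), Fintype.card {c // IsBasicCover G k c}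
        ≤ ∑ _k : Fin (N + 1), C * (N + 1) ^ d := by
          refine Finset.sum_le_sum fun k _ => ?_
          rw [← Nat.card_eq_fintype_card]
          exact (hC k).trans (Nat.mul_le_mul_left _ (Nat.pow_le_pow_left (by omega) d))
      _ = C * (N + 1) ^ (d + 1) := by simp; ring

/-- A multiplicative assignment on covers that kills the vertex variables induces an algebra
homomorphism out of the fiber cone. -/
theorem exists_algHom_fiberCone {B : Type*} [CommRing B] [Algebra K B]
    (w : ℕ → (V →₀ ℕ) → B) (hone : w 0 0 = 1)
    (hmul : ∀ k l c d, IsCover G k c → IsCover G l d → w (k + l) (c + d) = w k c * w l d)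
    (hzero : ∀ v, w 0 (Finsupp.single v 1) = 0) :
    ∃ φ : FiberCone K G →ₐ[K] B, ∀ k c (hc : IsCover G k c), φ (fiberMonomial K k c hc) = w k c := by
  -- The linear map is defined from all values of `w`, but `A(G)` is spanned by cover monomials, so
  -- multiplicativity is needed on covers only.
  let L : VertexCoverRing K G →ₗ[K] B :=
    (Polynomial.lsum fun k => (MvPolynomial.basisMonomials V K).constr K (w k)).comp
      (VertexCoverRing.incl K G).toLinearMap
  have hL : ∀ k c (hc : IsCover G k c), L (coverMonomial K k c hc) = w k c := by
    intro k c hc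
    have h1 : (MvPolynomial.basisMonomials V K).constr K (w k) (MvPolynomial.monomial c 1) =
        w k c := by
      exact (congrArg _ (by simp)).trans (Module.Basis.constr_basis _ K (w k) c)
    change Polynomial.lsum _ (Polynomial.monomial k (MvPolynomial.monomial c 1)) = _
    rw [Polynomial.lsum_apply, Polynomial.sum_monomial_index]
    · exact h1
    · exact map_zero _
  have hLmul : ∀ f g, L (f * g) = L f * L g := by
    intro f g
    have hf : f ∈ (⊤ : Submodule K (VertexCoverRing K G)) := Submodule.mem_top
    have hg : g ∈ (⊤ : Submodule K (VertexCoverRing K G)) := Submodule.mem_top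
    rw [← span_coverMonomial] at hf hg
    induction hf, hg using Submodule.span_induction₂ with
    | mem_mem x y hx hy =>
      obtain ⟨c, rfl⟩ := hx
      obtain ⟨d, rfl⟩ := hy
      rw [coverMonomial_mul, hL, hL, hL, hmul _ _ _ _ c.2 d.2]
    | zero_left y _ => simp
    | zero_right x _ => simp
    | add_left x y z _ _ _ h1 h2 => rw [add_mul, map_add, map_add, h1, h2, add_mul]
    | add_right x y z _ _ _ h1 h2 => rw [mul_add, map_add, map_add, h1, h2, mul_add]
    | smul_left r x y _ _ h => rw [smul_mul_assoc, map_smul, map_smul, h, smul_mul_assoc]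
    | smul_right r x y _ _ h => rw [mul_smul_comm, map_smul, map_smul, h, mul_smul_comm]
  let Φ : VertexCoverRing K G →ₐ[K] B := AlgHom.ofLinearMap L
    (by rw [← coverMonomial_zero, hL, hone]) hLmul
  refine ⟨Ideal.Quotient.liftₐ (irrelevantExtension K G) Φ ?_, fun k c hc => hL k c hc⟩
  intro f hf
  have hle : irrelevantExtension K G ≤ RingHom.ker Φ := by
    rw [irrelevantExtension, Ideal.map_span, Ideal.span_le]
    rintro _ ⟨_, ⟨v, rfl⟩, rfl⟩
    change L _ = 0
    rw [algebraMap_X_eq_coverMonomial, hL, hzero]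
  exact hle hf

end FiberCone

/-! ### Cyclic sequences without strict peaks -/

section NoPeak

/-- No entry of the cyclic sequence `q` exceeds both of its neighbours. -/
def HasNoPeak {α : Type*} [LE α] {a : ℕ} [NeZero a] (q : Fin a → α) : Prop :=
  ∀ i, q i ≤ q (i - 1) ∨ q i ≤ q (i + 1)

/-- A neighbour at least as large as a maximal entry is itself maximal, and `2 ≤ a` makes it a
different position. -/
theorem HasNoPeak.exists_ne {α : Type*} [PartialOrder α] {a : ℕ} [NeZero a] (ha : 2 ≤ a)
    {q : Fin a → α} (hq : HasNoPeak q) {i : Fin a} (hi : ∀ j, q j ≤ q i) :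
    ∃ j, j ≠ i ∧ q j = q i := by
  have h10 : (1 : Fin a) ≠ 0 := by
    intro h
    have := congrArg Fin.val h
    rw [Fin.val_one', Fin.val_zero, Nat.mod_eq_of_lt (by omega)] at this
    omega
  rcases hq i with h | h
  · exact ⟨i - 1, fun h' => h10 (sub_eq_self.mp h'), le_antisymm (hi _) h⟩
  · exact ⟨i + 1, fun h' => h10 (add_eq_left.mp h'), le_antisymm (hi _) h⟩

/-- The number of cyclic sequences of length `a` without strict peaks that take exactly the values
`0, …, m - 1`. -/
noncomputable def noPeakSurjections (a : ℕ) [NeZero a] (m : ℕ) : ℕ :=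
  Nat.card {q : Fin a → Fin m // Function.Surjective q ∧ HasNoPeak q}

theorem noPeakSurjections_eq_zero {a : ℕ} [NeZero a] (ha : 2 ≤ a) {m : ℕ} (hm : a ≤ m) :
    noPeakSurjections a m = 0 := by
  rw [noPeakSurjections, Nat.card_eq_zero]
  refine Or.inl ⟨fun ⟨q, hs, hq⟩ => ?_⟩
  have hinj : Function.Injective q := by
    have hle := Fintype.card_le_of_surjective q hs
    have hc : Fintype.card (Fin a) = Fintype.card (Fin m) := by simp at hle ⊢; omega
    exact ((Fintype.bijective_iff_surjective_and_card q).mpr ⟨hs, hc⟩).1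
  obtain ⟨i, -, hi⟩ := Finset.exists_max_image Finset.univ q Finset.univ_nonempty
  obtain ⟨j, hj, h⟩ := hq.exists_ne ha (fun j => hi j (Finset.mem_univ j))
  exact hj (hinj h)

/-- The increasing enumeration of `s` preserves and reflects `≤`, hence also the absence of peaks.
-/
theorem card_hasNoPeak_image_eq {a : ℕ} [NeZero a] {n : ℕ} (s : Finset (Fin n)) :
    Nat.card {q : Fin a → Fin n // HasNoPeak q ∧ Finset.univ.image q = s} =
      noPeakSurjections a s.card := by
  symm
  have hmem : ∀ (x : Fin n), x ∈ s ↔ ∃ j, s.orderEmbOfFin rfl j = x := by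
    intro x
    rw [← Finset.mem_coe, ← Finset.range_orderEmbOfFin s rfl]
    rfl
  refine Nat.card_congr (Equiv.ofBijective (fun p => ⟨fun i => s.orderEmbOfFin rfl (p.1 i), ?_, ?_⟩)
    ⟨?_, ?_⟩)
  · intro i
    simpa only [OrderEmbedding.le_iff_le] using p.2.2 i
  · ext x
    rw [hmem]
    simp only [Finset.mem_image, Finset.mem_univ, true_and]
    constructor
    · rintro ⟨i, hi⟩; exact ⟨_, hi⟩
    · rintro ⟨j, hj⟩
      obtain ⟨i, rfl⟩ := p.2.1 j
      exact ⟨i, hj⟩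
  · intro p p' h
    refine Subtype.ext (funext fun i => ?_)
    exact (s.orderEmbOfFin rfl).injective (congrFun (congrArg Subtype.val h) i)
  · rintro ⟨q, hq, hs⟩
    have h1 : ∀ i, ∃ j, s.orderEmbOfFin rfl j = q i := fun i =>
      (hmem _).mp (hs ▸ Finset.mem_image_of_mem q (Finset.mem_univ i))
    choose p hp using h1
    refine ⟨⟨p, fun j => ?_, fun i => ?_⟩, Subtype.ext (funext hp)⟩
    · have h2 : s.orderEmbOfFin rfl j ∈ Finset.univ.image q :=
        Finset.mem_of_subset hs.ge ((hmem _).mpr ⟨j, rfl⟩)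
      obtain ⟨i, -, hi⟩ := Finset.mem_image.mp h2
      exact ⟨i, (s.orderEmbOfFin rfl).injective ((hp i).trans hi)⟩
    · have := hq i
      simpa only [← hp, OrderEmbedding.le_iff_le] using this

/-- Sequences without strict peaks with values in an `n`-element chain, sorted by their image. -/
theorem card_hasNoPeak {a : ℕ} [NeZero a] (ha : 2 ≤ a) (n : ℕ) :
    Nat.card {q : Fin a → Fin n // HasNoPeak q} =
      ∑ m ∈ Finset.range a, n.choose m * noPeakSurjections a m := by
  classical
  have h1 : Nat.card {q : Fin a → Fin n // HasNoPeak q} =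
      ∑ s ∈ (Finset.univ : Finset (Fin n)).powerset, noPeakSurjections a s.card := by
    rw [Nat.card_eq_fintype_card, Fintype.card_subtype,
      Finset.card_eq_sum_card_fiberwise (f := fun q => Finset.univ.image q)
        (t := (Finset.univ : Finset (Fin n)).powerset) (fun q _ => by simp)]
    refine Finset.sum_congr rfl fun s _ => ?_
    rw [← card_hasNoPeak_image_eq, Nat.card_eq_fintype_card, Fintype.card_subtype,
      Finset.filter_filter]
  rw [h1, Finset.sum_powerset_apply_card, Finset.card_univ, Fintype.card_fin]
  simp only [smul_eq_mul]
  -- Both sums are compared on `range (n + 1 + a)`: terms with `m > n` have zero binomial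
  -- coefficient, terms with `m ≥ a` have no surjections.
  rw [Finset.sum_subset (Finset.range_subset_range.mpr (Nat.le_add_right (n + 1) a)),
    ← Finset.sum_subset (Finset.range_subset_range.mpr (Nat.le_add_left a (n + 1)))]
  · intro m _ hm
    rw [noPeakSurjections_eq_zero ha (by simpa using hm), mul_zero]
  · intro m _ hm
    rw [Nat.choose_eq_zero_of_lt (by simpa using hm), zero_mul]

theorem noPeakSurjections_pos (n : ℕ) : 0 < noPeakSurjections (n + 2) (n + 1) := by
  have : Nonempty {q : Fin (n + 2) → Fin (n + 1) // Function.Surjective q ∧ HasNoPeak q} := by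
    -- The sequence `0, 1, …, n, n`: every entry is at most its right neighbour, except that the
    -- last one equals its left neighbour.
    refine ⟨fun i => ⟨min i n, by omega⟩, fun j => ⟨j.castSucc, ?_⟩, fun i => ?_⟩
    · apply Fin.ext
      simp only [Fin.val_castSucc]
      omega
    · simp only [Fin.mk_le_mk]
      by_cases hi : i = Fin.last (n + 1)
      · left
        subst hi
        rw [Fin.val_sub_one_of_ne_zero (by simp)]
        simp
      · right
        rw [Fin.val_add_one_of_lt (Fin.lt_last_iff_ne_last.mpr hi)]
        omega
  exact Nat.card_pos

theorem noPeakSurjections_le (n : ℕ) :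
    noPeakSurjections (n + 2) (n + 1) ≤ (n + 2).choose 2 * n.factorial := by
  classical
  let S := (Finset.univ : Finset (Fin (n + 2) → Fin (n + 1))).filter
    fun q => Function.Surjective q ∧ HasNoPeak q
  let f : (Fin (n + 2) → Fin (n + 1)) → Finset (Fin (n + 2)) :=
    fun q => Finset.univ.filter fun i => q i = Fin.last n
  have hS : noPeakSurjections (n + 2) (n + 1) = S.card := by
    rw [noPeakSurjections, Nat.card_eq_fintype_card, Fintype.card_subtype]
  have hlast : ((Finset.univ : Finset (Fin (n + 1))).erase (Fin.last n)).card = n := by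
    simp
  have hsurj : ∀ q ∈ S, Set.SurjOn q ((f q)ᶜ : Finset _)
      ((Finset.univ : Finset (Fin (n + 1))).erase (Fin.last n) : Finset _) := by
    intro q hq y hy
    obtain ⟨i, rfl⟩ := (Finset.mem_filter.mp hq).2.1 y
    refine ⟨i, ?_, rfl⟩
    simpa [f] using hy
  -- The other `n` values need at least `n` of the `n + 2` positions, leaving at most two for the
  -- top value; the no-peak condition requires two.
  have hcard : ∀ q ∈ S, (f q).card = 2 := by
    intro q hq
    have h1 : n ≤ ((f q)ᶜ).card :=
      hlast.ge.trans (Finset.card_le_card_of_surjOn q (hsurj q hq))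
    rw [Finset.card_compl, Fintype.card_fin] at h1
    obtain ⟨i, hi⟩ := (Finset.mem_filter.mp hq).2.1 (Fin.last n)
    obtain ⟨j, hji, hj⟩ := (Finset.mem_filter.mp hq).2.2.exists_ne (by omega)
      (i := i) (fun j => hi ▸ Fin.le_last _)
    have h2 : 1 < (f q).card := Finset.one_lt_card.mpr
      ⟨j, by simp [f, hj, hi], i, by simp [f, hi], hji⟩
    have h3 := Finset.card_le_univ (f q)
    rw [Fintype.card_fin] at h3
    omega
  -- Once the two top positions are fixed, `q` is a bijection from the other `n` positions to the
  -- other `n` values.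
  have hfib : ∀ s ∈ Finset.powersetCard 2 (Finset.univ : Finset (Fin (n + 2))),
      (S.filter fun q => f q = s).card ≤ n.factorial := by
    intro s hs
    have hs2 : (sᶜ).card = n := by
      rw [Finset.card_compl, (Finset.mem_powersetCard.mp hs).2, Fintype.card_fin]; rfl
    have hinj : ∀ q ∈ S.filter fun q => f q = s, Set.InjOn q (sᶜ : Finset _) := by
      intro q hq
      obtain ⟨hqS, rfl⟩ := Finset.mem_filter.mp hq
      refine Finset.injOn_of_surjOn_of_card_le q ?_ (hsurj q hqS) (by rw [hs2, hlast])
      intro i hi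
      simpa [f] using hi
    let g : (S.filter fun q => f q = s) →
        ((sᶜ : Finset (Fin (n + 2))) ↪
          ((Finset.univ : Finset (Fin (n + 1))).erase (Fin.last n) : Finset _)) := fun q =>
      ⟨fun i => ⟨q.1 i, by
        have h1 : i.1 ∉ f q.1 := by
          rw [(Finset.mem_filter.mp q.2).2]
          exact Finset.mem_compl.mp i.2
        simpa [f] using h1⟩, fun i j h => Subtype.ext (hinj q.1 q.2 i.2 j.2 (congrArg Subtype.val h))⟩
    have hg : Function.Injective g := by
      intro q q' h
      refine Subtype.ext (funext fun i => ?_)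
      by_cases hi : i ∈ s
      · have h1 := (Finset.mem_filter.mp q.2).2
        have h2 := (Finset.mem_filter.mp q'.2).2
        have h3 : i ∈ f q.1 := h1.symm ▸ hi
        have h4 : i ∈ f q'.1 := h2.symm ▸ hi
        rw [(Finset.mem_filter.mp h3).2, (Finset.mem_filter.mp h4).2]
      · exact congrArg Subtype.val (DFunLike.congr_fun h ⟨i, Finset.mem_compl.mpr hi⟩)
    have h5 := Fintype.card_le_of_injective g hg
    rw [Fintype.card_embedding_eq, Fintype.card_coe, Fintype.card_coe, Fintype.card_coe, hs2,
      hlast, Nat.descFactorial_self] at h5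
    exact h5
  have hmain := Finset.card_le_mul_card_image_of_maps_to
    (t := Finset.powersetCard 2 (Finset.univ : Finset (Fin (n + 2)))) (s := S) (f := f)
    (fun q hq => Finset.mem_powersetCard.mpr ⟨Finset.subset_univ _, hcard q hq⟩) _ hfib
  rw [Finset.card_powersetCard, Finset.card_univ, Fintype.card_fin] at hmain
  rw [hS, mul_comm]
  exact hmain

end NoPeak

/-! ### Binomial sums as polynomials -/

/-- A sum of binomial coefficients `binom(k + 1, m)`, `m ≤ d`, is a polynomial in `k` of degree
`d`. -/
theorem exists_polynomial_eval_eq_sum_choose (d : ℕ) (N : ℕ → ℕ) (hN : N d ≠ 0) :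
    ∃ P : Polynomial ℚ, (∀ k : ℕ, ((∑ m ∈ Finset.range (d + 1), (k + 1).choose m * N m : ℕ) : ℚ) =
      P.eval (k : ℚ)) ∧ P.degree = (d : WithBot ℕ) ∧ (N d : ℚ) = d.factorial * P.leadingCoeff := by
  -- `binom(k + 1, m)` is the falling factorial of `k + 1` over `m!`; substituting `X + 1` keeps it
  -- monic of degree `m`.
  let Q : ℕ → Polynomial ℚ := fun m =>
    Polynomial.C ((N m : ℚ) / m.factorial) * (descPochhammer ℚ m).comp (Polynomial.X + Polynomial.C 1)
  have hmonic : ∀ m, ((descPochhammer ℚ m).comp (Polynomial.X + Polynomial.C 1)).Monic :=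
    fun m => (monic_descPochhammer ℚ m).comp_X_add_C 1
  have hdeg : ∀ m, ((descPochhammer ℚ m).comp (Polynomial.X + Polynomial.C 1)).degree =
      (m : WithBot ℕ) := by
    intro m
    rw [Polynomial.degree_eq_natDegree (hmonic m).ne_zero, Polynomial.natDegree_comp,
      descPochhammer_natDegree, Polynomial.natDegree_X_add_C, mul_one]
  have hc : (N d : ℚ) / d.factorial ≠ 0 :=
    div_ne_zero (Nat.cast_ne_zero.mpr hN) (Nat.cast_ne_zero.mpr d.factorial_ne_zero)
  have hQd : (Q d).degree = (d : WithBot ℕ) := by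
    rw [Polynomial.degree_C_mul hc, hdeg]
  have hlt : (∑ m ∈ Finset.range d, Q m).degree < (Q d).degree := by
    rw [hQd]
    refine (Polynomial.degree_sum_le _ _).trans_lt ((Finset.sup_lt_iff (WithBot.bot_lt_coe d)).mpr
      fun m hm => ?_)
    refine (Polynomial.degree_mul_le _ _).trans_lt ?_
    rw [hdeg]
    refine (add_le_add_left Polynomial.degree_C_le _).trans_lt ?_
    rw [zero_add]
    exact WithBot.coe_lt_coe.mpr (Finset.mem_range.mp hm)
  refine ⟨∑ m ∈ Finset.range (d + 1), Q m, fun k => ?_, ?_, ?_⟩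
  · rw [Polynomial.eval_finsetSum, Nat.cast_sum]
    refine Finset.sum_congr rfl fun m _ => ?_
    have h1 : ((k : ℚ) + 1) = ((k + 1 : ℕ) : ℚ) := by push_cast; ring
    rw [Polynomial.eval_mul, Polynomial.eval_C, Polynomial.eval_comp, Polynomial.eval_add,
      Polynomial.eval_X, Polynomial.eval_C, h1, descPochhammer_eval_eq_descFactorial,
      Nat.descFactorial_eq_factorial_mul_choose]
    have : (m.factorial : ℚ) ≠ 0 := Nat.cast_ne_zero.mpr m.factorial_ne_zero
    push_cast
    field_simp
  · rw [Finset.sum_range_succ, Polynomial.degree_add_eq_right_of_degree_lt hlt, hQd]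
  · rw [Finset.sum_range_succ, Polynomial.leadingCoeff_add_of_degree_lt hlt,
      Polynomial.leadingCoeff_mul, Polynomial.leadingCoeff_C, (hmonic d).leadingCoeff]
    have : (d.factorial : ℚ) ≠ 0 := Nat.cast_ne_zero.mpr d.factorial_ne_zero
    field_simp

theorem sum_choose_mul_le (d : ℕ) (N : ℕ → ℕ) (k : ℕ) :
    ∑ m ∈ Finset.range (d + 1), (k + 1).choose m * N m ≤
      (∑ m ∈ Finset.range (d + 1), N m) * (k + 1) ^ d := by
  rw [Finset.sum_mul]
  refine Finset.sum_le_sum fun m hm => ?_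
  rw [mul_comm]
  refine Nat.mul_le_mul_left _ ((Nat.choose_le_pow _ _).trans ?_)
  exact Nat.pow_le_pow_right (by omega) (by have := Finset.mem_range.mp hm; omega)

/-! ### The even cycle -/

section EvenCycle

/-- The even-numbered vertices of the cycle with `2 * a` vertices. -/
def evenVertex {a : ℕ} (i : Fin a) : Fin (2 * a) := ⟨2 * i, by omega⟩

/-- The odd-numbered vertices of the cycle with `2 * a` vertices. -/
def oddVertex {a : ℕ} (i : Fin a) : Fin (2 * a) := ⟨2 * i + 1, by omega⟩

@[simp] theorem evenVertex_val {a : ℕ} (i : Fin a) : (evenVertex i : ℕ) = 2 * i := rfl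

@[simp] theorem oddVertex_val {a : ℕ} (i : Fin a) : (oddVertex i : ℕ) = 2 * i + 1 := rfl

theorem evenVertex_injective {a : ℕ} : Function.Injective (evenVertex (a := a)) := by
  intro i j h
  have := congrArg Fin.val h
  simp only [evenVertex_val] at this
  omega

theorem oddVertex_injective {a : ℕ} : Function.Injective (oddVertex (a := a)) := by
  intro i j h
  have := congrArg Fin.val h
  simp only [oddVertex_val] at this
  omega

theorem evenVertex_ne_oddVertex {a : ℕ} (i j : Fin a) : evenVertex i ≠ oddVertex j := by
  intro h
  have := congrArg Fin.val h
  simp only [evenVertex_val, oddVertex_val] at this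
  omega

theorem exists_evenVertex_or_oddVertex {a : ℕ} (v : Fin (2 * a)) :
    (∃ i, evenVertex i = v) ∨ ∃ i, oddVertex i = v := by
  rcases Nat.even_or_odd' v.val with ⟨i, h | h⟩
  · exact Or.inl ⟨⟨i, by omega⟩, Fin.ext h.symm⟩
  · exact Or.inr ⟨⟨i, by omega⟩, Fin.ext h.symm⟩

/-- The vector on the vertices of the even cycle with prescribed even and odd entries. -/
noncomputable def interleave {a : ℕ} (p q : Fin a → ℕ) : Fin (2 * a) →₀ ℕ :=
  Finsupp.equivFunOnFinite.symm fun v =>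
    if (v : ℕ) % 2 = 0 then p ⟨v / 2, by omega⟩ else q ⟨v / 2, by omega⟩

theorem interleave_evenVertex {a : ℕ} (p q : Fin a → ℕ) (i : Fin a) :
    interleave p q (evenVertex i) = p i := by
  simp [interleave]

theorem interleave_oddVertex {a : ℕ} (p q : Fin a → ℕ) (i : Fin a) :
    interleave p q (oddVertex i) = q i := by
  have h : (2 * (i : ℕ) + 1) / 2 = i := by omega
  simp [interleave, h]

variable {a : ℕ} [NeZero a]

theorem Fin.val_add_one_cyclic (ha : 2 ≤ a) (i : Fin a) :
    ((i + 1 : Fin a) : ℕ) = i + 1 ∧ (i : ℕ) + 1 < a ∨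
      ((i + 1 : Fin a) : ℕ) = 0 ∧ (i : ℕ) + 1 = a := by
  rw [Fin.val_add, Fin.val_one', Nat.mod_eq_of_lt (show 1 < a by omega)]
  rcases Nat.lt_or_ge ((i : ℕ) + 1) a with h | h
  · exact Or.inl ⟨Nat.mod_eq_of_lt h, h⟩
  · have : (i : ℕ) + 1 = a := by omega
    exact Or.inr ⟨by rw [this, Nat.mod_self], this⟩

theorem Fin.add_one_ne_self (ha : 2 ≤ a) (i : Fin a) : i + 1 ≠ i := by
  intro h
  have h1 := Fin.val_add_one_cyclic ha i
  rw [h] at h1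
  omega

theorem cycleGraph_adj_iff_val {n : ℕ} (hn : 2 ≤ n) (u v : Fin n) :
    (SimpleGraph.cycleGraph n).Adj u v ↔
      (u : ℕ) + 1 = v ∨ (v : ℕ) + 1 = u ∨ (u : ℕ) + 1 = n ∧ (v : ℕ) = 0 ∨
        (v : ℕ) + 1 = n ∧ (u : ℕ) = 0 := by
  have key : ∀ u v : Fin n, (u - v).val = 1 ↔
      (v : ℕ) + 1 = u ∨ (v : ℕ) + 1 = n ∧ (u : ℕ) = 0 := by
    intro u v
    rw [Fin.val_sub]
    have hu := u.2
    have hv := v.2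
    rcases Nat.lt_or_ge (n - v + u) n with h | h
    · rw [Nat.mod_eq_of_lt h]; omega
    · rw [Nat.mod_eq_sub_mod h, Nat.mod_eq_of_lt (by omega)]; omega
  rw [SimpleGraph.cycleGraph_adj', key, key]
  tauto

theorem cycleGraph_adj_oddVertex (ha : 2 ≤ a) (i : Fin a) (v : Fin (2 * a)) :
    (SimpleGraph.cycleGraph (2 * a)).Adj (oddVertex i) v ↔
      v = evenVertex i ∨ v = evenVertex (i + 1) := by
  have h1 := Fin.val_add_one_cyclic ha i
  rw [cycleGraph_adj_iff_val (by omega), Fin.ext_iff, Fin.ext_iff]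
  simp only [evenVertex_val, oddVertex_val]
  omega

theorem cycleGraph_adj_evenVertex (ha : 2 ≤ a) (i : Fin a) (v : Fin (2 * a)) :
    (SimpleGraph.cycleGraph (2 * a)).Adj (evenVertex i) v ↔
      v = oddVertex i ∨ v = oddVertex (i - 1) := by
  have h1 := Fin.val_add_one_cyclic ha (i - 1)
  rw [sub_add_cancel] at h1
  rw [cycleGraph_adj_iff_val (by omega), Fin.ext_iff, Fin.ext_iff]
  simp only [evenVertex_val, oddVertex_val]
  omega

theorem isCover_cycleGraph (ha : 2 ≤ a) (k : ℕ) (c : Fin (2 * a) →₀ ℕ) :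
    IsCover (SimpleGraph.cycleGraph (2 * a)) k c ↔
      ∀ i : Fin a, k ≤ c (evenVertex i) + c (oddVertex i) ∧
        k ≤ c (oddVertex i) + c (evenVertex (i + 1)) := by
  constructor
  · intro h i
    exact ⟨h _ _ ((cycleGraph_adj_evenVertex ha _ _).mpr (Or.inl rfl)),
      h _ _ ((cycleGraph_adj_oddVertex ha _ _).mpr (Or.inr rfl))⟩
  · intro h u v huv
    rcases exists_evenVertex_or_oddVertex u with ⟨i, rfl⟩ | ⟨i, rfl⟩
    · rcases (cycleGraph_adj_evenVertex ha _ _).mp huv with rfl | rfl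
      · exact (h i).1
      · have := (h (i - 1)).2
        rw [sub_add_cancel] at this
        omega
    · rcases (cycleGraph_adj_oddVertex ha _ _).mp huv with rfl | rfl
      · have := (h i).1
        omega
      · exact (h i).2

/-- Odd vertex `i` lies between even vertices `i` and `i + 1`. A nonzero even entry has a tight
edge, and the cover inequalities then give the `min` formula. With that formula, the edge from odd
`i` to even `i` is tight iff `q i ≤ q (i - 1)`, and the edge to even `i + 1` iff `q i ≤ q (i + 1)`.
-/
theorem isBasicCover_cycleGraph (ha : 2 ≤ a) (k : ℕ) (c : Fin (2 * a) →₀ ℕ) :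
    IsBasicCover (SimpleGraph.cycleGraph (2 * a)) k c ↔
      (∀ i, c (oddVertex i) ≤ k) ∧ (HasNoPeak fun i => c (oddVertex i)) ∧
      ∀ i, c (evenVertex i) = k - min (c (oddVertex (i - 1))) (c (oddVertex i)) := by
  rw [IsBasicCover, isCover_cycleGraph ha]
  constructor
  · rintro ⟨hcov, hb⟩
    have hle : ∀ v, c v ≤ k := by
      intro v
      by_cases hv : c v = 0
      · omega
      · obtain ⟨w, -, hw⟩ := hb v hv
        omega
    have hcov' : ∀ i, k ≤ c (oddVertex (i - 1)) + c (evenVertex i) := by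
      intro i
      have := (hcov (i - 1)).2
      rwa [sub_add_cancel] at this
    refine ⟨fun i => hle _, fun i => ?_, fun i => ?_⟩
    · change c _ ≤ c _ ∨ c _ ≤ c _
      by_cases hi : c (oddVertex i) = 0
      · exact Or.inl (by omega)
      · obtain ⟨w, hadj, hw⟩ := hb _ hi
        rcases (cycleGraph_adj_oddVertex ha _ _).mp hadj with rfl | rfl
        · left
          have := hcov' i
          omega
        · right
          have := (hcov (i + 1)).1
          omega
    · have h1 := hcov' i
      have h2 := (hcov i).1
      have h3 := hle (oddVertex i)
      have h4 := hle (oddVertex (i - 1))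
      by_cases hi : c (evenVertex i) = 0
      · omega
      · obtain ⟨w, hadj, hw⟩ := hb _ hi
        rcases (cycleGraph_adj_evenVertex ha _ _).mp hadj with rfl | rfl <;> omega
  · rintro ⟨hle, hq, heven⟩
    refine ⟨fun i => ?_, fun v hv => ?_⟩
    · have h1 := heven i
      have h2 := heven (i + 1)
      rw [add_sub_cancel_right] at h2
      omega
    · rcases exists_evenVertex_or_oddVertex v with ⟨i, rfl⟩ | ⟨i, rfl⟩
      · have h1 := heven i
        have h2 := hle i
        have h3 := hle (i - 1)
        -- The tight edge at an even vertex leads to its smaller odd neighbour.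
        rcases le_total (c (oddVertex (i - 1))) (c (oddVertex i)) with h | h
        · exact ⟨_, (cycleGraph_adj_evenVertex ha _ _).mpr (Or.inr rfl), by omega⟩
        · exact ⟨_, (cycleGraph_adj_evenVertex ha _ _).mpr (Or.inl rfl), by omega⟩
      · have h0 := hle i
        have h1 := heven i
        have h2 := heven (i + 1)
        rw [add_sub_cancel_right] at h2
        rcases hq i with h | h
        · refine ⟨_, (cycleGraph_adj_oddVertex ha _ _).mpr (Or.inl rfl), ?_⟩
          simp only at h
          omega
        · refine ⟨_, (cycleGraph_adj_oddVertex ha _ _).mpr (Or.inr rfl), ?_⟩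
          simp only at h
          omega

/-- Basic covers of the even cycle correspond to cyclic sequences without strict peaks. -/
theorem exists_bijective_basicCover (ha : 2 ≤ a) (k : ℕ) :
    ∃ f : {c // IsBasicCover (SimpleGraph.cycleGraph (2 * a)) k c} →
      {q : Fin a → Fin (k + 1) // HasNoPeak q}, Function.Bijective f := by
  refine ⟨fun c => ⟨fun i => ⟨c.1 (oddVertex i), ?_⟩, ?_⟩, ?_, ?_⟩
  · have := ((isBasicCover_cycleGraph ha k c.1).mp c.2).1 i
    omega
  · exact fun i => ((isBasicCover_cycleGraph ha k c.1).mp c.2).2.1 i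
  · intro c d h
    have hodd : ∀ i, c.1 (oddVertex i) = d.1 (oddVertex i) := fun i =>
      congrArg Fin.val (congrFun (congrArg Subtype.val h) i)
    refine Subtype.ext (Finsupp.ext fun v => ?_)
    rcases exists_evenVertex_or_oddVertex v with ⟨i, rfl⟩ | ⟨i, rfl⟩
    · rw [((isBasicCover_cycleGraph ha k c.1).mp c.2).2.2 i,
        ((isBasicCover_cycleGraph ha k d.1).mp d.2).2.2 i, hodd, hodd]
    · exact hodd i
  · rintro ⟨q, hq⟩
    refine ⟨⟨interleave (fun i => k - min (q (i - 1) : ℕ) (q i)) (fun i => q i),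
      (isBasicCover_cycleGraph ha k _).mpr ⟨fun i => ?_, fun i => ?_, fun i => ?_⟩⟩, ?_⟩
    · rw [interleave_oddVertex]; have := (q i).2; omega
    · simp only [interleave_oddVertex]
      exact hq i
    · simp only [interleave_oddVertex, interleave_evenVertex]
    · refine Subtype.ext (funext fun i => Fin.ext ?_)
      exact interleave_oddVertex (fun i => k - min (q (i - 1) : ℕ) (q i)) (fun i => (q i : ℕ)) i

theorem card_isBasicCover (ha : 2 ≤ a) (k : ℕ) :
    Nat.card {c // IsBasicCover (SimpleGraph.cycleGraph (2 * a)) k c} =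
      ∑ m ∈ Finset.range a, (k + 1).choose m * noPeakSurjections a m := by
  obtain ⟨f, hf⟩ := exists_bijective_basicCover ha k
  rw [Nat.card_congr (Equiv.ofBijective f hf), card_hasNoPeak ha]

theorem finite_isBasicCover (ha : 2 ≤ a) (k : ℕ) :
    Finite {c // IsBasicCover (SimpleGraph.cycleGraph (2 * a)) k c} := by
  obtain ⟨f, hf⟩ := exists_bijective_basicCover ha k
  exact Finite.of_injective f hf.1

end EvenCycle

/-! ### The graphical dimension of the even cycle -/

section GraphicalDimension

variable {a : ℕ} [NeZero a]

theorem StandardDrawing.admissible_r {V : Type*} {G : SimpleGraph V} (Γ : StandardDrawing G) :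
    Γ.Admissible Γ.r :=
  Nat.sSup_mem (s := {r | Γ.Admissible r})
    ⟨0, Nat.zero_le _, fun _ _ h => absurd h (Nat.not_lt_zero _),
      fun _ _ h => absurd h (Nat.not_lt_zero _)⟩ ⟨Γ.a, fun _ h => h.1⟩

theorem StandardDrawing.le_r {V : Type*} {G : SimpleGraph V} (Γ : StandardDrawing G) {r : ℕ}
    (h : Γ.Admissible r) : r ≤ Γ.r :=
  le_csSup ⟨Γ.a, fun _ h => h.1⟩ h

theorem exists_adj_ne_cycleGraph (ha : 2 ≤ a) (u : Fin (2 * a)) :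
    ∃ v w, v ≠ w ∧ (SimpleGraph.cycleGraph (2 * a)).Adj u v ∧
      (SimpleGraph.cycleGraph (2 * a)).Adj u w := by
  rcases exists_evenVertex_or_oddVertex u with ⟨i, rfl⟩ | ⟨i, rfl⟩
  · refine ⟨oddVertex i, oddVertex (i - 1), fun h => ?_,
      (cycleGraph_adj_evenVertex ha _ _).mpr (Or.inl rfl),
      (cycleGraph_adj_evenVertex ha _ _).mpr (Or.inr rfl)⟩
    have := Fin.add_one_ne_self ha (i - 1)
    rw [sub_add_cancel] at this
    exact this (oddVertex_injective h)
  · exact ⟨evenVertex i, evenVertex (i + 1),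
      fun h => Fin.add_one_ne_self ha i (evenVertex_injective h).symm,
      (cycleGraph_adj_oddVertex ha _ _).mpr (Or.inl rfl),
      (cycleGraph_adj_oddVertex ha _ _).mpr (Or.inr rfl)⟩

/-- If `r` reached `a`, both lines would have length `a`, and the last upper vertex could be joined
only to the vertex below it, although every vertex has two neighbours. -/
theorem StandardDrawing.r_lt_of_cycleGraph (ha : 2 ≤ a)
    (Γ : StandardDrawing (SimpleGraph.cycleGraph (2 * a))) : Γ.r < a := by
  by_contra! hr
  obtain ⟨hle, -, hslash⟩ := Γ.admissible_r
  have hcard := Fintype.card_congr Γ.vertex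
  simp only [Fintype.card_sum, Fintype.card_fin] at hcard
  have hab := Γ.a_le_b
  have hΓa : Γ.a = a := by omega
  have hΓb : Γ.b = a := by omega
  have hnbr : ∀ v, (SimpleGraph.cycleGraph (2 * a)).Adj
      (Γ.vertex (Sum.inl ⟨a - 1, by omega⟩)) v → v = Γ.vertex (Sum.inr ⟨a - 1, by omega⟩) := by
    intro v hv
    obtain ⟨x, rfl⟩ := Γ.vertex.surjective v
    rcases x with i | j
    · exact absurd hv (Γ.upper_not_adj _ _)
    · have hj := j.2
      by_cases h : (j : ℕ) < a - 1
      · exact absurd hv (hslash _ j (by simp; omega) h)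
      · congr 2
        apply Fin.ext
        simp only
        omega
  obtain ⟨v, w, hvw, hv, hw⟩ := exists_adj_ne_cycleGraph ha
    (Γ.vertex (Sum.inl ⟨a - 1, by omega⟩))
  exact hvw ((hnbr v hv).trans (hnbr w hw).symm)

/-- The drawing of the even cycle with the odd vertices above the even ones. -/
noncomputable def oddEvenDrawing (ha : 2 ≤ a) :
    StandardDrawing (SimpleGraph.cycleGraph (2 * a)) where
  a := a
  b := a
  a_le_b := le_rfl
  vertex := Equiv.ofBijective (Sum.elim oddVertex evenVertex) ⟨by
    rintro (i | i) (j | j) h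
    · exact congrArg Sum.inl (oddVertex_injective h)
    · exact absurd h.symm (evenVertex_ne_oddVertex j i)
    · exact absurd h (evenVertex_ne_oddVertex i j)
    · exact congrArg Sum.inr (evenVertex_injective h), by
    intro v
    rcases exists_evenVertex_or_oddVertex v with ⟨i, rfl⟩ | ⟨i, rfl⟩
    · exact ⟨Sum.inr i, rfl⟩
    · exact ⟨Sum.inl i, rfl⟩⟩
  upper_not_adj i j h := by
    rcases (cycleGraph_adj_oddVertex ha _ _).mp h with h | h <;>
      exact evenVertex_ne_oddVertex _ _ h.symm
  lower_not_adj i j h := by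
    rcases (cycleGraph_adj_evenVertex ha _ _).mp h with h | h <;>
      exact evenVertex_ne_oddVertex _ _ h

theorem oddEvenDrawing_joined (ha : 2 ≤ a) (i j : Fin a) :
    (oddEvenDrawing ha).Joined i j ↔ j = i ∨ j = i + 1 := by
  change (SimpleGraph.cycleGraph (2 * a)).Adj (oddVertex i) (evenVertex j) ↔ _
  rw [cycleGraph_adj_oddVertex ha, evenVertex_injective.eq_iff, evenVertex_injective.eq_iff]

/-- The only slash edge is the one closing the cycle, and it starts at the last upper position. -/
theorem oddEvenDrawing_admissible (ha : 2 ≤ a) : (oddEvenDrawing ha).Admissible (a - 1) := by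
  refine ⟨Nat.sub_le _ _, fun (i : Fin a) (j : Fin a) _ hij => ?_,
    fun (i : Fin a) (j : Fin a) hi hij h => ?_⟩
  · exact (oddEvenDrawing_joined ha i j).mpr (Or.inl (Fin.ext hij))
  · rcases (oddEvenDrawing_joined ha i j).mp h with rfl | rfl
    · exact lt_irrefl _ hij
    · have h1 := Fin.val_add_one_cyclic ha i
      change (i : ℕ) < a - 1 at hi
      change ((i + 1 : Fin a) : ℕ) < i at hij
      omega

theorem graphicalDimension_cycleGraph (ha : 2 ≤ a) :
    graphicalDimension (SimpleGraph.cycleGraph (2 * a)) = a := by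
  have h : IsGreatest {r | ∃ Γ : StandardDrawing (SimpleGraph.cycleGraph (2 * a)), Γ.r = r}
      (a - 1) := by
    refine ⟨⟨oddEvenDrawing ha, le_antisymm ?_
      ((oddEvenDrawing ha).le_r (oddEvenDrawing_admissible ha))⟩, ?_⟩
    · have := (oddEvenDrawing ha).r_lt_of_cycleGraph ha
      omega
    · rintro _ ⟨Γ, rfl⟩
      have := Γ.r_lt_of_cycleGraph ha
      omega
  rw [graphicalDimension, h.csSup_eq]
  omega

end GraphicalDimension

/-! ### The Krull dimension of the fiber cone of the even cycle -/

section KrullDimension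

/-- The `k`-covers of the cycle on `2 * (n + 2)` vertices for which the edges of a fixed edge cover
with `n + 1` components are tight. -/
def IsTightCover {n : ℕ} (k : ℕ) (c : Fin (2 * (n + 2)) →₀ ℕ) : Prop :=
  c (evenVertex 0) + c (oddVertex 0) = k ∧
    c (evenVertex (Fin.last (n + 1))) + c (oddVertex (Fin.last (n + 1))) = k ∧
    ∀ i : Fin (n + 2), i ≠ Fin.last (n + 1) → c (oddVertex i) + c (evenVertex (i + 1)) = k

/-- The coordinates of a tight cover with respect to a basis of the monoid of tight covers. -/
noncomputable def tightExponent {n : ℕ} (k : ℕ) (c : Fin (2 * (n + 2)) →₀ ℕ) : Fin (n + 2) →₀ ℕ :=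
  Finsupp.equivFunOnFinite.symm fun j =>
    -- The exponents are the successive differences of `0, c (oddVertex 0), …, c (oddVertex n), k`.
    -- The last odd vertex is omitted: tightness forces it to agree with the odd vertex before it.
    (if j = Fin.last (n + 1) then k else c (oddVertex j)) -
      (if j = 0 then 0 else c (oddVertex (j - 1)))

variable {n : ℕ}

/-- Two inequalities sum to an equality only if both are equalities. Hence sending non-tight covers
to zero is multiplicative. -/
theorem isTightCover_add {k l : ℕ} {c d : Fin (2 * (n + 2)) →₀ ℕ}
    (hc : IsCover (SimpleGraph.cycleGraph (2 * (n + 2))) k c)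
    (hd : IsCover (SimpleGraph.cycleGraph (2 * (n + 2))) l d) :
    IsTightCover (k + l) (c + d) ↔ IsTightCover k c ∧ IsTightCover l d := by
  rw [isCover_cycleGraph (by omega)] at hc hd
  simp only [IsTightCover, Finsupp.add_apply]
  have h0 := (hc 0).1
  have h0' := (hd 0).1
  have h1 := (hc (Fin.last (n + 1))).1
  have h1' := (hd (Fin.last (n + 1))).1
  constructor
  · rintro ⟨e0, e1, e2⟩
    refine ⟨⟨by omega, by omega, fun i hi => ?_⟩, ⟨by omega, by omega, fun i hi => ?_⟩⟩ <;>
    · have := e2 i hi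
      have := (hc i).2
      have := (hd i).2
      omega
  · rintro ⟨⟨e0, e1, e2⟩, f0, f1, f2⟩
    refine ⟨by omega, by omega, fun i hi => ?_⟩
    have := e2 i hi
    have := f2 i hi
    omega

/-- Tightness makes even entry `j` equal to `k` minus odd entry `j - 1`, so covering the edge from
even `j` to odd `j` says that odd entries increase. This makes the truncated subtraction in
`tightExponent` exact, hence additive. -/
theorem IsTightCover.le {k : ℕ} {c : Fin (2 * (n + 2)) →₀ ℕ} (h : IsTightCover k c)
    (hc : IsCover (SimpleGraph.cycleGraph (2 * (n + 2))) k c) (j : Fin (n + 2)) :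
    (if j = 0 then 0 else c (oddVertex (j - 1))) ≤
      (if j = Fin.last (n + 1) then k else c (oddVertex j)) := by
  rw [isCover_cycleGraph (by omega)] at hc
  by_cases h0 : j = 0
  · simp [h0]
  · have h1 : j - 1 ≠ Fin.last (n + 1) := by
      intro h1
      rw [sub_eq_iff_eq_add, Fin.last_add_one] at h1
      exact h0 h1
    have h2 := h.2.2 _ h1
    rw [sub_add_cancel] at h2
    have h3 := (hc j).1
    rw [if_neg h0]
    split_ifs <;> omega

theorem tightExponent_add {k l : ℕ} {c d : Fin (2 * (n + 2)) →₀ ℕ}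
    (hc : IsCover (SimpleGraph.cycleGraph (2 * (n + 2))) k c)
    (hd : IsCover (SimpleGraph.cycleGraph (2 * (n + 2))) l d)
    (htc : IsTightCover k c) (htd : IsTightCover l d) :
    tightExponent (k + l) (c + d) = tightExponent k c + tightExponent l d := by
  ext j
  have h1 := htc.le hc j
  have h2 := htd.le hd j
  simp only [tightExponent, Finsupp.equivFunOnFinite_symm_apply_apply, Finsupp.add_apply]
  split_ifs at h1 h2 ⊢ <;> omega

/-- The tight edges meet every vertex; this is what sends the variables of `𝔪` to zero. -/
theorem not_isTightCover_single (v : Fin (2 * (n + 2))) :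
    ¬ IsTightCover 0 (Finsupp.single v 1) := by
  rintro ⟨h0, h1, h2⟩
  have hv : Finsupp.single v 1 v = 1 := Finsupp.single_eq_same
  rcases exists_evenVertex_or_oddVertex v with ⟨i, rfl⟩ | ⟨i, rfl⟩
  · by_cases hi : i = 0
    · subst hi; omega
    · have h3 : i - 1 ≠ Fin.last (n + 1) := by
        intro h3
        rw [sub_eq_iff_eq_add, Fin.last_add_one] at h3
        exact hi h3
      have h4 := h2 _ h3
      rw [sub_add_cancel] at h4
      omega
  · by_cases hi : i = Fin.last (n + 1)
    · subst hi; omega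
    · have := h2 i hi
      omega

/-- The tight `1`-covers that generate the monoid of tight covers. -/
noncomputable def tightGenerator (j : Fin (n + 2)) : Fin (2 * (n + 2)) →₀ ℕ :=
  -- The odd entries jump from `0` to `1` at position `j`, so only the `j`-th difference is `1`; for
  -- the last `j` the jump is the final one to `k = 1`, and all odd entries vanish. Tightness
  -- dictates the even entries.
  interleave (fun i => if i ≤ j ∧ ¬ (i = 0 ∧ j = 0) then 1 else 0)
    (fun i => if j ≤ i ∧ j ≠ Fin.last (n + 1) then 1 else 0)

theorem Fin.val_add_one_of_ne_last {i : Fin (n + 2)} (hi : i ≠ Fin.last (n + 1)) :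
    ((i + 1 : Fin (n + 2)) : ℕ) = i + 1 :=
  Fin.val_add_one_of_lt (Fin.lt_last_iff_ne_last.mpr hi)

theorem isCover_tightGenerator (j : Fin (n + 2)) :
    IsCover (SimpleGraph.cycleGraph (2 * (n + 2))) 1 (tightGenerator j) := by
  rw [isCover_cycleGraph (by omega)]
  intro i
  simp only [tightGenerator, interleave_evenVertex, interleave_oddVertex]
  have hj := j.2
  refine ⟨?_, ?_⟩
  · simp only [Fin.le_def, Fin.ext_iff, Fin.val_last, Fin.val_zero, ne_eq]
    split_ifs <;> omega
  · by_cases hi : i = Fin.last (n + 1)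
    · subst hi
      rw [Fin.last_add_one]
      simp only [Fin.le_def, Fin.ext_iff, Fin.val_last, Fin.val_zero, ne_eq, true_and]
      split_ifs <;> omega
    · have hi' : (i : ℕ) ≠ n + 1 := fun h => hi (Fin.ext h)
      simp only [Fin.le_def, Fin.ext_iff, Fin.val_last, Fin.val_zero, ne_eq,
        Fin.val_add_one_of_ne_last hi]
      split_ifs <;> omega

theorem isTightCover_tightGenerator (j : Fin (n + 2)) : IsTightCover 1 (tightGenerator j) := by
  have hj := j.2
  simp only [IsTightCover, tightGenerator, interleave_evenVertex, interleave_oddVertex]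
  refine ⟨?_, ?_, fun i hi => ?_⟩
  · simp only [Fin.le_def, Fin.ext_iff, Fin.val_last, Fin.val_zero, ne_eq, true_and]
    split_ifs <;> omega
  · simp only [Fin.le_def, Fin.ext_iff, Fin.val_last, Fin.val_zero, ne_eq]
    split_ifs <;> omega
  · have hi' : (i : ℕ) ≠ n + 1 := fun h => hi (Fin.ext h)
    have := i.2
    simp only [Fin.le_def, Fin.ext_iff, Fin.val_last, Fin.val_zero, ne_eq,
      Fin.val_add_one_of_ne_last hi]
    split_ifs <;> omega

theorem tightExponent_tightGenerator (j : Fin (n + 2)) :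
    tightExponent 1 (tightGenerator j) = Finsupp.single j 1 := by
  classical
  ext i
  have hj := j.2
  have hi := i.2
  simp only [tightExponent, Finsupp.equivFunOnFinite_symm_apply_apply, tightGenerator,
    interleave_oddVertex, Finsupp.single_apply]
  by_cases h0 : i = 0
  · subst h0
    simp only [Fin.le_def, Fin.ext_iff, Fin.val_last, Fin.val_zero, ne_eq]
    split_ifs <;> omega
  · have h1 : ((i - 1 : Fin (n + 2)) : ℕ) = i - 1 := Fin.val_sub_one_of_ne_zero h0
    have h2 : (i : ℕ) ≠ 0 := fun h => h0 (Fin.ext h)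
    simp only [Fin.le_def, Fin.ext_iff, Fin.val_last, Fin.val_zero, ne_eq, h1]
    split_ifs <;> omega

variable (K : Type*) [Field K]

/-- The fiber cone of the even cycle surjects onto a polynomial ring. -/
theorem exists_surjective_algHom_fiberCone (n : ℕ) :
    ∃ φ : FiberCone K (SimpleGraph.cycleGraph (2 * (n + 2))) →ₐ[K] MvPolynomial (Fin (n + 2)) K,
      Function.Surjective φ := by
  classical
  let w : ℕ → (Fin (2 * (n + 2)) →₀ ℕ) → MvPolynomial (Fin (n + 2)) K := fun k c =>
    if IsTightCover k c then MvPolynomial.monomial (tightExponent k c) 1 else 0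
  have hone : w 0 0 = 1 := by
    have h : IsTightCover 0 (0 : Fin (2 * (n + 2)) →₀ ℕ) := by simp [IsTightCover]
    have h' : tightExponent 0 (0 : Fin (2 * (n + 2)) →₀ ℕ) = 0 := by
      ext j; simp [tightExponent]
    simp only [w]
    rw [if_pos h, h']
    rfl
  have hmul : ∀ k l c d, IsCover (SimpleGraph.cycleGraph (2 * (n + 2))) k c →
      IsCover (SimpleGraph.cycleGraph (2 * (n + 2))) l d →
      w (k + l) (c + d) = w k c * w l d := by
    intro k l c d hc hd
    simp only [w, isTightCover_add hc hd]
    by_cases htc : IsTightCover k c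
    · by_cases htd : IsTightCover l d
      · rw [if_pos ⟨htc, htd⟩, if_pos htc, if_pos htd, tightExponent_add hc hd htc htd,
          MvPolynomial.monomial_mul, one_mul]
      · rw [if_neg fun h => htd h.2, if_neg htd, mul_zero]
    · rw [if_neg fun h => htc h.1, if_neg htc, zero_mul]
  obtain ⟨φ, hφ⟩ := exists_algHom_fiberCone K w hone hmul
    fun v => if_neg (not_isTightCover_single v)
  refine ⟨φ, ?_⟩
  rw [← AlgHom.range_eq_top, eq_top_iff, ← MvPolynomial.adjoin_range_X, Algebra.adjoin_le_iff]
  rintro _ ⟨j, rfl⟩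
  refine ⟨fiberMonomial K 1 (tightGenerator j) (isCover_tightGenerator j), ?_⟩
  refine (hφ _ _ _).trans ?_
  simp only [w]
  rw [if_pos (isTightCover_tightGenerator j), tightExponent_tightGenerator]
  rfl

theorem ringKrullDim_fiberCone_cycleGraph (n : ℕ) :
    ringKrullDim (FiberCone K (SimpleGraph.cycleGraph (2 * (n + 2)))) = ((n + 2 : ℕ) : WithBot ℕ∞) := by
  apply le_antisymm
  · have := finite_isBasicCover (a := n + 2) (by omega)
    refine ringKrullDim_fiberCone_le K _
      (∑ m ∈ Finset.range (n + 1 + 1), noPeakSurjections (n + 2) m) (n + 1) fun k => ?_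
    rw [card_isBasicCover (by omega)]
    exact sum_choose_mul_le (n + 1) _ k
  · obtain ⟨φ, hφ⟩ := exists_surjective_algHom_fiberCone K n
    have h := ringKrullDim_le_of_surjective φ.toRingHom hφ
    rw [MvPolynomial.ringKrullDim_of_isNoetherianRing, ringKrullDim_eq_zero_of_field,
      Nat.card_eq_fintype_card, Fintype.card_fin, zero_add] at h
    exact h

/-- Here the Hilbert function is polynomial for every `k`, and positivity of the top count
guarantees the degree `n + 1`. -/
theorem hasMultiplicity_fiberCone_cycleGraph (n : ℕ) :
    HasMultiplicity (fiberConeGrading K (SimpleGraph.cycleGraph (2 * (n + 2))))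
      (noPeakSurjections (n + 2) (n + 1) : ℚ) := by
  obtain ⟨P, hP, hdeg, hlead⟩ := exists_polynomial_eval_eq_sum_choose (n + 1)
    (noPeakSurjections (n + 2)) (noPeakSurjections_pos n).ne'
  refine ⟨n + 1, P, ringKrullDim_fiberCone_cycleGraph K n, Filter.Eventually.of_forall fun k => ?_,
    hdeg, hlead⟩
  rw [← hP, hilbertFunction_fiberConeGrading, card_isBasicCover (by omega)]

end KrullDimension

theorem mainTheorem6 (K : Type*) [Field K] (a : ℕ) (ha : 2 ≤ a) :
    graphicalDimension (SimpleGraph.cycleGraph (2 * a)) = a ∧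
    ringKrullDim (FiberCone K (SimpleGraph.cycleGraph (2 * a))) = (a : WithBot ℕ∞) ∧
    ∃ e : ℕ, HasMultiplicity (fiberConeGrading K (SimpleGraph.cycleGraph (2 * a))) (e : ℚ) ∧
      e ≤ a.choose 2 * (a - 2).factorial := by
  obtain ⟨n, rfl⟩ : ∃ n, a = n + 2 := ⟨a - 2, by omega⟩
  exact ⟨graphicalDimension_cycleGraph ha, ringKrullDim_fiberCone_cycleGraph K n,
    _, hasMultiplicity_fiberCone_cycleGraph K n, noPeakSurjections_le n⟩
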